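/- For an integer $k\ge 0$ let $\mathrm{Sym}^{k}(\mathbb{C}^2)$ be the $k$-th symmetric power of the standard representation of $\mathrm{SL}_2(\mathbb{C})$ (the binary forms of degree $k$). Let $r:\mathrm{GL}_n(\mathbb{C})\to\mathrm{GL}(V)$ be a representation and $G\le \mathrm{GL}_n(\mathbb{C})$ a subgroup; $r$ *detects* $G$ if $G$ fixes a line in $V$, i.e. if there is a one-dimensional subspace $L\subseteq V$ with $r(g)L=L$ for all $g\in G$. **Theorem.** Let $n\ge 1$ be an integer. Then $\dim_{\mathbb{C}}\mathrm{Sym}^{n-1}(\mathbb{C}^2)=n$. For any choice of a basis of $\mathrm{Sym}^{n-1}(\mathbb{C}^2)$, let $G=\mathrm{Sym}^{n-1}(\mathrm{SL}_2)\le\mathrm{GL}_n(\mathbb{C})$ be the image of $\mathrm{SL}_2(\mathbb{C})$ acting on $\mathrm{Sym}^{n-1}(\mathbb{C}^2)\cong\mathbb{C}^n$. Then the representation $\mathrm{Sym}^3=\mathrm{Sym}^3(\mathbb{C}^n)$ of $\mathrm{GL}_n(\mathbb{C})$ detects $G$ if and only if $n\equiv 1\pmod 4$. Moreover, with $k=n-1$,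 there is a nonzero $\mathrm{SL}_2(\mathbb{C})$-invariant vector in $\mathrm{Sym}^3(\mathrm{Sym}^{k}(\mathbb{C}^2))$ if and only if $4\mid k$. -/

import Mathlib

open scoped TensorProduct MatrixGroups

noncomputable section

namespace SymDetect

section Functoriality

variable {R ι : Type} [CommRing R] {M N P : Type} [AddCommGroup M] [Module R M]
  [AddCommGroup N] [Module R N] [AddCommGroup P] [Module R P]

/-- The linear map `Sym^ι M → Sym^ι N` induced by a linear map `f : M → N`; it sends the
symmetric product of the `m i` to the symmetric product of the `f (m i)`. -/
def symMap (f : M →ₗ[R] N) : SymmetricPower R ι M →ₗ[R] SymmetricPower R ι N where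
  toFun := AddCon.lift _
    ((SymmetricPower.mk R ι N).comp (PiTensorProduct.map fun _ : ι => f)).toAddMonoidHom
    (AddCon.addConGen_le.2 fun x y h => by
      cases h with
      | perm e m =>
        change SymmetricPower.mk R ι N (PiTensorProduct.map (fun _ => f) _)
          = SymmetricPower.mk R ι N (PiTensorProduct.map (fun _ => f) _)
        rw [PiTensorProduct.map_tprod, PiTensorProduct.map_tprod]
        exact (SymmetricPower.tprod_equiv e fun i => f (m i)).symm)
  map_add' := map_add _
  map_smul' r x := by
    induction x using AddCon.induction_on with
    | H x =>
      exact map_smul ((SymmetricPower.mk R ι N).comp (PiTensorProduct.map fun _ : ι => f)) r x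

theorem symMap_tprod (f : M →ₗ[R] N) (m : ι → M) :
    symMap f (SymmetricPower.tprod R m) = SymmetricPower.tprod R fun i => f (m i) := by
  change SymmetricPower.mk R ι N (PiTensorProduct.map (fun _ => f) _) = _
  rw [PiTensorProduct.map_tprod]
  rfl

theorem sym_hom_ext {f g : SymmetricPower R ι M →ₗ[R] P}
    (h : ∀ m : ι → M, f (SymmetricPower.tprod R m) = g (SymmetricPower.tprod R m)) : f = g :=
  LinearMap.ext_on_range (SymmetricPower.span_tprod_eq_top R ι M) h

/-- The symmetric power `Sym^k` of a representation `ρ` of `G` on `M`, acting on `Sym^k M` by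
`g • (m₁ ⋯ mₖ) = (g • m₁) ⋯ (g • mₖ)`. -/
def symPow {G : Type} [Monoid G] (ρ : Representation R G M) (k : ℕ) :
    Representation R G (SymmetricPower R (Fin k) M) where
  toFun g := symMap (ρ g)
  map_one' := sym_hom_ext fun m => by simp [symMap_tprod]
  map_mul' g h := sym_hom_ext fun m => by simp [symMap_tprod]

end Functoriality

/-- The standard representation of `GL_n(ℂ)` on `ℂ^n`. -/
def stdGL (n : ℕ) : Representation ℂ (GL (Fin n) ℂ) (Fin n → ℂ) :=
  ((Matrix.toLinAlgEquiv' : Matrix (Fin n) (Fin n) ℂ ≃ₐ[ℂ] _) : _ →* _).comp (Units.coeHom _)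

/-- The standard representation of `SL_2(ℂ)` on `ℂ^2`. -/
def stdSL2 : Representation ℂ SL(2, ℂ) (Fin 2 → ℂ) :=
  (stdGL 2).comp Matrix.SpecialLinearGroup.toGL

/-- The homomorphism `H → GL_n(ℂ)` expressing a representation of a group `H` on an
`n`-dimensional space in the coordinates given by a basis. -/
def matrixHom {H M : Type} [Group H] [AddCommGroup M] [Module ℂ M] {n : ℕ}
    (ρ : Representation ℂ H M) (b : Module.Basis (Fin n) ℂ M) : H →* GL (Fin n) ℂ :=
  (Units.map ((LinearMap.toMatrixAlgEquiv b : _ ≃ₐ[ℂ] Matrix (Fin n) (Fin n) ℂ) : _ →* _)).comp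
    (MonoidHom.toHomUnits ρ)

/-- The subgroup `Sym^k(SL_2)` of `GL_n(ℂ)`: the image of `SL_2(ℂ)` acting on `Sym^k(ℂ^2)`,
where `Sym^k(ℂ^2)` is identified with `ℂ^n` by the basis `b`. -/
def symSL2 {n k : ℕ} (b : Module.Basis (Fin n) ℂ (SymmetricPower ℂ (Fin k) (Fin 2 → ℂ))) :
    Subgroup (GL (Fin n) ℂ) :=
  (matrixHom (symPow stdSL2 k) b).range

/-- A representation `r` of `GL_n(ℂ)` on `V` detects a subgroup `G` if `G` fixes a line in `V`,
that is, if some one-dimensional subspace of `V` is mapped to itself by every element of `G`. -/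
def Detects {n : ℕ} {V : Type} [AddCommGroup V] [Module ℂ V]
    (r : Representation ℂ (GL (Fin n) ℂ) V) (G : Subgroup (GL (Fin n) ℂ)) : Prop :=
  ∃ L : Submodule ℂ V, Module.finrank ℂ L = 1 ∧ ∀ g ∈ G, L.map (r g) = L

end SymDetect

end

/-! A tensor `x` in Sym³(Symᵏ ℂ²) is encoded by `cubicEval x`, a symmetric function of three points
of ℂ², homogeneous of degree `k` in each. The encoding is faithful even on distinct points of the
chart (1, t) (`eq_zero_of_cubicEval`), and SL₂ acts by moving the points.

Necessity: SL₂ moves any three distinct points of the projective line to a fixed triple, so a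
nonzero semi-invariant has nonzero value there. Now `diagI` multiplies that triple by i up to a
swap, and, being a commutator, fixes every semi-invariant. Hence i^(3k) = 1 and 4 ∣ k
(`four_dvd_of_semiinvariant`).

Sufficiency: for k = 2m with m even, the m-th power of the product of the three brackets is
symmetric and SL₂-invariant; `invariantCubic` realises it up to the factor 6. -/

noncomputable section

namespace SymDetect

/-! ### Maps out of symmetric powers and the permanent pairing -/

section SymmetricPowerLift

variable {R ι : Type} [CommRing R] {M N P : Type} [AddCommGroup M] [Module R M]
  [AddCommGroup N] [Module R N] [AddCommGroup P] [Module R P]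

/-- The linear map out of a symmetric power induced by a symmetric multilinear map. -/
def symLift (f : MultilinearMap R (fun _ : ι => M) P)
    (hf : ∀ (e : Equiv.Perm ι) (m : ι → M), f (fun i => m (e i)) = f m) :
    SymmetricPower R ι M →ₗ[R] P where
  toFun := AddCon.lift _ (PiTensorProduct.lift f).toAddMonoidHom
    (AddCon.addConGen_le.2 fun x y h => by
      cases h with
      | perm e m =>
        rw [AddCon.ker_rel]
        simp [hf e m])
  map_add' := map_add _
  map_smul' r x := by
    induction x using AddCon.induction_on with
    | H x => exact map_smul (PiTensorProduct.lift f) r x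

@[simp]
theorem symLift_tprod (f : MultilinearMap R (fun _ : ι => M) P)
    (hf : ∀ (e : Equiv.Perm ι) (m : ι → M), f (fun i => m (e i)) = f m) (m : ι → M) :
    symLift f hf (SymmetricPower.tprod R m) = f m := by
  exact PiTensorProduct.lift.tprod m

variable [Fintype ι] [DecidableEq ι]

variable (R ι M) in
/-- The symmetrization map from the symmetric power to the tensor power. -/
def symmetrize : SymmetricPower R ι M →ₗ[R] ⨂[R] _ : ι, M :=
  symLift (∑ σ : Equiv.Perm ι, (PiTensorProduct.tprod R).domDomCongr σ) fun e m => by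
    simp only [sum_apply, MultilinearMap.domDomCongr_apply]
    exact Fintype.sum_equiv (Equiv.mulLeft e) _ _ fun σ => rfl

theorem symmetrize_tprod (m : ι → M) :
    symmetrize R ι M (SymmetricPower.tprod R m) =
      ∑ σ : Equiv.Perm ι, PiTensorProduct.tprod R fun i => m (σ i) := by
  simp [symmetrize]

theorem mk_symmetrize (x : SymmetricPower R ι M) :
    SymmetricPower.mk R ι M (symmetrize R ι M x) = (Fintype.card ι).factorial • x := by
  suffices h : SymmetricPower.mk R ι M ∘ₗ symmetrize R ι M =
      (Fintype.card ι).factorial • LinearMap.id from LinearMap.congr_fun h x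
  refine sym_hom_ext fun m => ?_
  have h (σ : Equiv.Perm ι) : SymmetricPower.mk R ι M (PiTensorProduct.tprod R fun i => m (σ i)) =
      SymmetricPower.tprod R m := SymmetricPower.tprod_equiv σ m
  simp [symmetrize_tprod, h, Fintype.card_perm]

/-- The pairing of a symmetric tensor with linear forms: the symmetric product of the `m i` is
sent to the permanent of the matrix of the `ℓ i (m j)`. -/
def pairing (x : SymmetricPower R ι M) :
    MultilinearMap R (fun _ : ι => Module.Dual R M) R :=
  (LinearMap.applyₗ (symmetrize R ι M x) ∘ₗ PiTensorProduct.dualDistrib).compMultilinearMap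
    (PiTensorProduct.tprod R)

/-- The linear form on the symmetric power given by the pairing with a family of linear forms. -/
def pairingForm (ℓ : ι → Module.Dual R M) : SymmetricPower R ι M →ₗ[R] R :=
  PiTensorProduct.dualDistrib (PiTensorProduct.tprod R ℓ) ∘ₗ symmetrize R ι M

theorem pairing_eq (x : SymmetricPower R ι M) (ℓ : ι → Module.Dual R M) :
    pairing x ℓ = pairingForm ℓ x := rfl

theorem pairingForm_tprod (ℓ : ι → Module.Dual R M) (m : ι → M) :
    pairingForm ℓ (SymmetricPower.tprod R m) = ∑ σ : Equiv.Perm ι, ∏ i, ℓ i (m (σ i)) := by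
  simp [pairingForm, symmetrize_tprod]

theorem pairingForm_tprod' (ℓ : ι → Module.Dual R M) (m : ι → M) :
    pairingForm ℓ (SymmetricPower.tprod R m) = ∑ σ : Equiv.Perm ι, ∏ i, ℓ (σ i) (m i) := by
  rw [pairingForm_tprod]
  refine Fintype.sum_equiv (Equiv.inv _) _ _ fun σ => ?_
  exact Fintype.prod_equiv σ _ _ fun i => by simp

theorem pairingForm_symMap (ℓ : ι → Module.Dual R N) (f : M →ₗ[R] N)
    (x : SymmetricPower R ι M) :
    pairingForm ℓ (symMap f x) = pairingForm (fun i => ℓ i ∘ₗ f) x := by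
  suffices h : pairingForm ℓ ∘ₗ symMap f = pairingForm (fun i => ℓ i ∘ₗ f) from
    LinearMap.congr_fun h x
  refine sym_hom_ext fun m => ?_
  simp [symMap_tprod, pairingForm_tprod]

theorem pairingForm_perm (ℓ : ι → Module.Dual R M) (e : Equiv.Perm ι)
    (x : SymmetricPower R ι M) :
    pairingForm (fun i => ℓ (e i)) x = pairingForm ℓ x := by
  suffices h : pairingForm (fun i => ℓ (e i)) = pairingForm ℓ from LinearMap.congr_fun h x
  refine sym_hom_ext fun m => ?_
  rw [pairingForm_tprod', pairingForm_tprod']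
  exact Fintype.sum_equiv (Equiv.mulLeft e) _ _ fun σ => rfl

end SymmetricPowerLift

/-- Products of dual basis forms are the coordinates of the tensor power, so the symmetrization of
`x` vanishes; projecting back gives a factorial times `x`, and the factorial is invertible. -/
theorem eq_zero_of_pairing_eq_zero {K ι M : Type} [Field K] [CharZero K] [AddCommGroup M]
    [Module K M] [Fintype ι] [DecidableEq ι] {x : SymmetricPower K ι M} (hx : pairing x = 0) :
    x = 0 := by
  let b := Module.Free.chooseBasis K M
  have h : symmetrize K ι M x = 0 := by
    refine (Basis.piTensorProduct fun _ : ι => b).ext_elem fun p => ?_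
    have h1 : (Basis.piTensorProduct fun _ : ι => b).coord p =
        PiTensorProduct.dualDistrib (PiTensorProduct.tprod K fun i => b.coord (p i)) := by
      ext m
      simp [Basis.piTensorProduct_repr_tprod_apply]
    have h2 : pairing x (fun i => b.coord (p i)) = 0 := by simp [hx]
    rw [map_zero, Finsupp.zero_apply, ← Module.Basis.coord_apply, h1]
    exact h2
  have h3 := mk_symmetrize (R := K) x
  rw [h, map_zero, ← Nat.cast_smul_eq_nsmul K] at h3
  exact (smul_eq_zero.1 h3.symm).resolve_left (by exact_mod_cast Nat.factorial_ne_zero _)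

/-! ### Binary forms: monomial basis and point evaluations -/

section BinaryForms

/-- Evaluation of a binary form of degree `k` at a linear form on `ℂ^2`. -/
def evalForm (k : ℕ) (φ : Fin 2 → ℂ) : SymmetricPower ℂ (Fin k) (Fin 2 → ℂ) →ₗ[ℂ] ℂ :=
  symLift ((MultilinearMap.mkPiAlgebra ℂ (Fin k) ℂ).compLinearMap
      fun _ => dotProductEquiv ℂ (Fin 2) φ) fun e m => by
    simpa using Equiv.prod_comp e fun i => φ ⬝ᵥ m i

theorem evalForm_tprod (k : ℕ) (φ : Fin 2 → ℂ) (u : Fin k → Fin 2 → ℂ) :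
    evalForm k φ (SymmetricPower.tprod ℂ u) = ∏ i, φ ⬝ᵥ u i := by
  simp [evalForm]

theorem evalForm_smul (k : ℕ) (c : ℂ) (φ : Fin 2 → ℂ) :
    evalForm k (c • φ) = c ^ k • evalForm k φ := by
  refine sym_hom_ext fun u => ?_
  simp [evalForm_tprod, Finset.prod_mul_distrib]

theorem stdSL2_apply (g : SL(2, ℂ)) (u : Fin 2 → ℂ) :
    stdSL2 g u = Matrix.mulVec (g : Matrix (Fin 2) (Fin 2) ℂ) u := rfl

theorem evalForm_comp_symPow (k : ℕ) (φ : Fin 2 → ℂ) (g : SL(2, ℂ)) :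
    evalForm k φ ∘ₗ symPow stdSL2 k g =
      evalForm k (Matrix.vecMul φ (g : Matrix (Fin 2) (Fin 2) ℂ)) := by
  refine sym_hom_ext fun u => ?_
  have h : symPow stdSL2 k g (SymmetricPower.tprod ℂ u) =
    SymmetricPower.tprod ℂ fun i => stdSL2 g (u i) := symMap_tprod _ _
  simp only [LinearMap.comp_apply, h, evalForm_tprod, stdSL2_apply, Matrix.dotProduct_mulVec]

/-- The monomial `X^i Y^(k-i)` of degree `k`. -/
def monomialForm (k i : ℕ) : SymmetricPower ℂ (Fin k) (Fin 2 → ℂ) :=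
  SymmetricPower.tprod ℂ fun j => if (j : ℕ) < i then Pi.single 0 1 else Pi.single 1 1

theorem evalForm_monomialForm {k i : ℕ} (hi : i ≤ k) (φ : Fin 2 → ℂ) :
    evalForm k φ (monomialForm k i) = φ 0 ^ i * φ 1 ^ (k - i) := by
  have h (j : Fin k) : φ ⬝ᵥ (if (j : ℕ) < i then Pi.single 0 1 else Pi.single 1 1) =
      if (j : ℕ) < i then φ 0 else φ 1 := by split_ifs <;> simp
  rw [monomialForm, evalForm_tprod, Finset.prod_congr rfl fun j _ => h j,
    Fin.prod_univ_eq_prod_range (fun j => if j < i then φ 0 else φ 1) k,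
    ← Finset.prod_range_mul_prod_Ico _ hi]
  congr 1
  · rw [Finset.prod_congr rfl fun j hj => if_pos (Finset.mem_range.1 hj)]
    simp
  · rw [Finset.prod_congr rfl fun j hj => if_neg (Finset.mem_Ico.1 hj).1.not_gt]
    simp

/-- Two maps with fibres of equal size differ by a permutation. This sorts a product of basis
vectors into a monomial. -/
theorem exists_perm_of_fin_two {k : ℕ} (f : Fin k → Fin 2) :
    ∃ i ≤ k, ∃ σ : Equiv.Perm (Fin k), ∀ j, f j = if (σ j : ℕ) < i then 0 else 1 := by
  refine ⟨Fintype.card {j // f j = 0}, by simpa using Fintype.card_subtype_le (f · = 0), ?_⟩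
  have hle : Fintype.card {j // f j = 0} ≤ k := by simpa using Fintype.card_subtype_le (f · = 0)
  set i := Fintype.card {j // f j = 0}
  let g : Fin k → Fin 2 := fun j => if (j : ℕ) < i then 0 else 1
  have h0 : Fintype.card {j // g j = 0} = i := by
    rw [Fintype.card_subtype]
    simp [g, Fin.card_filter_val_lt, hle]
  have hc (F : Fin k → Fin 2) : Fintype.card {j // F j = 1} = k - Fintype.card {j // F j = 0} := by
    have h := Fintype.card_subtype_compl (F · = 0)
    rw [Fintype.card_fin] at h
    rw [← h]
    exact Fintype.card_congr (Equiv.subtypeEquivRight fun j => by omega)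
  have he (c : Fin 2) : Nonempty ({j // f j = c} ≃ {j // g j = c}) := by
    refine ⟨Fintype.equivOfCardEq ?_⟩
    fin_cases c
    · exact h0.symm
    · exact (hc f).trans ((hc g).trans (by rw [h0])).symm
  exact ⟨Equiv.ofFiberEquiv fun c => (he c).some,
    fun j => (Equiv.ofFiberEquiv_map (fun c => (he c).some) j).symm⟩

theorem span_monomialForm (k : ℕ) :
    Submodule.span ℂ (Set.range fun i : Fin (k + 1) => monomialForm k i) = ⊤ := by
  rw [eq_top_iff, ← SymmetricPower.span_tprod_eq_top, Submodule.span_le]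
  rintro _ ⟨u, rfl⟩
  have hu : u = fun j => ∑ s : Fin 2, u j s • Pi.single s (1 : ℂ) := by
    ext j s
    fin_cases s <;> simp
  rw [hu, MultilinearMap.map_sum]
  refine Submodule.sum_mem _ fun f _ => ?_
  rw [MultilinearMap.map_smul_univ]
  refine Submodule.smul_mem _ _ (Submodule.subset_span ?_)
  obtain ⟨i, hi, σ, hσ⟩ := exists_perm_of_fin_two f
  refine ⟨⟨i, by omega⟩, ?_⟩
  dsimp only
  rw [monomialForm, ← SymmetricPower.tprod_equiv σ]
  congr 1
  ext1 j
  rw [hσ j]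
  split_ifs <;> rfl

/-- At (1, t) a form becomes a polynomial in t, here with infinitely many roots. The exceptional set
`s` later serves to avoid coinciding points. -/
theorem coeff_eq_zero_of_evalForm {k : ℕ} (c : Fin (k + 1) → ℂ) {s : Set ℂ} (hs : s.Finite)
    (h : ∀ t ∉ s, evalForm k ![1, t] (∑ i : Fin (k + 1), c i • monomialForm k i) = 0) : c = 0 := by
  let p : Polynomial ℂ := ∑ i : Fin (k + 1), Polynomial.monomial (k - i) (c i)
  have hp : p = 0 := by
    refine Polynomial.eq_zero_of_infinite_isRoot p (hs.infinite_compl.mono fun t ht => ?_)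
    have h1 := h t ht
    simp only [map_sum, map_smul, smul_eq_mul] at h1
    simp only [Set.mem_ofPred_eq, Polynomial.IsRoot, p, Polynomial.eval_finsetSum,
      Polynomial.eval_monomial]
    rw [← h1]
    refine Finset.sum_congr rfl fun i _ => ?_
    rw [evalForm_monomialForm (by omega)]
    simp
  ext i
  have h2 : p.coeff (k - i) = c i := by
    simp only [p, Polynomial.finsetSum_coeff, Polynomial.coeff_monomial]
    rw [Finset.sum_eq_single i (fun j _ hj => if_neg fun h => hj (by ext; omega)) (by simp)]
    simp
  simpa [hp] using h2.symm

/-- The monomials as a basis of the space of binary forms. -/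
def monomialBasis (k : ℕ) :
    Module.Basis (Fin (k + 1)) ℂ (SymmetricPower ℂ (Fin k) (Fin 2 → ℂ)) :=
  Module.Basis.mk (v := fun i : Fin (k + 1) => monomialForm k i)
    (Fintype.linearIndependent_iff.2 fun c hc => congr_fun
      (coeff_eq_zero_of_evalForm c Set.finite_empty fun t _ => by rw [hc, map_zero]))
    (span_monomialForm k).ge

theorem finrank_symPow (k : ℕ) :
    Module.finrank ℂ (SymmetricPower ℂ (Fin k) (Fin 2 → ℂ)) = k + 1 := by
  simp [Module.finrank_eq_card_basis (monomialBasis k)]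

instance (k : ℕ) : FiniteDimensional ℂ (SymmetricPower ℂ (Fin k) (Fin 2 → ℂ)) :=
  .of_basis (monomialBasis k)

theorem eq_zero_of_evalForm {k : ℕ} {s : Set ℂ} (hs : s.Finite)
    (x : SymmetricPower ℂ (Fin k) (Fin 2 → ℂ))
    (h : ∀ t ∉ s, evalForm k ![1, t] x = 0) : x = 0 := by
  obtain ⟨c, rfl⟩ := (Submodule.mem_span_range_iff_exists_fun ℂ).1
    ((span_monomialForm k).ge (Submodule.mem_top (x := x)))
  simp [coeff_eq_zero_of_evalForm c hs h]

theorem span_evalForm (k : ℕ) {s : Set ℂ} (hs : s.Finite) :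
    Submodule.span ℂ ((fun t => evalForm k ![1, t]) '' sᶜ) = ⊤ := by
  rw [← Subspace.dualCoannihilator_dualAnnihilator_eq (K := ℂ)
    (W := Submodule.span ℂ ((fun t => evalForm k ![1, t]) '' sᶜ))]
  suffices h : (Submodule.span ℂ ((fun t => evalForm k ![1, t]) '' sᶜ)).dualCoannihilator = ⊥ by
    rw [h, Submodule.dualAnnihilator_bot]
  refine (Submodule.eq_bot_iff _).2 fun x hx => eq_zero_of_evalForm hs x fun t ht => ?_
  exact (Submodule.mem_dualCoannihilator x).1 hx _ (Submodule.subset_span ⟨t, ht, rfl⟩)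

/-- Evaluations outside a finite set span the dual, so the slots can be freed one at a time: the
last avoiding two points, then the middle avoiding one, then the first. -/
theorem eq_zero_of_evalForm_triple {k : ℕ}
    (G : MultilinearMap ℂ
      (fun _ : Fin 3 => Module.Dual ℂ (SymmetricPower ℂ (Fin k) (Fin 2 → ℂ))) ℂ)
    (hG : ∀ t : Fin 3 → ℂ, Function.Injective t → G (fun i => evalForm k ![1, t i]) = 0) :
    G = 0 := by
  have hext {A : Module.Dual ℂ (Module.Dual ℂ (SymmetricPower ℂ (Fin k) (Fin 2 → ℂ)))}
      {s : Set ℂ} (hs : s.Finite) (h : ∀ t ∉ s, A (evalForm k ![1, t]) = 0) : A = 0 := by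
    refine LinearMap.ext_on (span_evalForm k hs) ?_
    rintro _ ⟨t, ht, rfl⟩
    exact h t ht
  have h0 (t : ℂ) (ℓ₁ ℓ₂) : G ![evalForm k ![1, t], ℓ₁, ℓ₂] = 0 := by
    have h1 (t' : ℂ) (ht' : t' ≠ t) (ℓ) : G ![evalForm k ![1, t], evalForm k ![1, t'], ℓ] = 0 := by
      have := hext (A := G.toLinearMap ![evalForm k ![1, t], evalForm k ![1, t'], 0] 2)
        (s := {t, t'}) (by simp) fun t'' ht'' => ?_
      · have h2 := LinearMap.congr_fun this ℓ
        rw [LinearMap.zero_apply] at h2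
        rw [← h2, MultilinearMap.toLinearMap_apply]
        congr 1
        ext1 i
        fin_cases i <;> rfl
      · have hinj : Function.Injective ![t, t', t''] := by
          intro i j hij
          simp only [Set.mem_insert_iff, Set.mem_singleton_iff, not_or] at ht''
          fin_cases i <;> fin_cases j <;> simp_all
        rw [← hG _ hinj]
        simp only [MultilinearMap.toLinearMap_apply]
        congr 1
        ext1 i
        fin_cases i <;> rfl
    have := hext (A := G.toLinearMap ![evalForm k ![1, t], 0, ℓ₂] 1)
      (s := {t}) (by simp) fun t' ht' => ?_
    · have h2 := LinearMap.congr_fun this ℓ₁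
      rw [LinearMap.zero_apply] at h2
      rw [← h2, MultilinearMap.toLinearMap_apply]
      congr 1
      ext1 i
      fin_cases i <;> rfl
    · rw [← h1 t' ht' ℓ₂, MultilinearMap.toLinearMap_apply]
      congr 1
      ext1 i
      fin_cases i <;> rfl
  ext ℓ
  have := hext (A := G.toLinearMap ℓ 0) Set.finite_empty fun t _ => ?_
  · simpa using LinearMap.congr_fun this (ℓ 0)
  · rw [← h0 t (ℓ 1) (ℓ 2), MultilinearMap.toLinearMap_apply]
    congr 1
    ext1 i
    fin_cases i <;> rfl

end BinaryForms

/-! ### Semi-invariant cubics force 4 ∣ k -/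

section CubicInvariants

variable {k : ℕ}

/-- The trihomogeneous function of three linear forms attached to a cubic tensor. -/
def cubicEval (x : SymmetricPower ℂ (Fin 3) (SymmetricPower ℂ (Fin k) (Fin 2 → ℂ)))
    (φ : Fin 3 → Fin 2 → ℂ) : ℂ :=
  pairingForm (fun i => evalForm k (φ i)) x

theorem cubicEval_smul_left (c : ℂ)
    (x : SymmetricPower ℂ (Fin 3) (SymmetricPower ℂ (Fin k) (Fin 2 → ℂ)))
    (φ : Fin 3 → Fin 2 → ℂ) : cubicEval (c • x) φ = c * cubicEval x φ := by
  simp [cubicEval]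

theorem cubicEval_sub (x y : SymmetricPower ℂ (Fin 3) (SymmetricPower ℂ (Fin k) (Fin 2 → ℂ)))
    (φ : Fin 3 → Fin 2 → ℂ) : cubicEval (x - y) φ = cubicEval x φ - cubicEval y φ := by
  simp [cubicEval]

theorem cubicEval_smul (c : Fin 3 → ℂ)
    (x : SymmetricPower ℂ (Fin 3) (SymmetricPower ℂ (Fin k) (Fin 2 → ℂ)))
    (φ : Fin 3 → Fin 2 → ℂ) :
    cubicEval x (fun i => c i • φ i) = (∏ i, c i) ^ k * cubicEval x φ := by
  simp only [cubicEval, evalForm_smul, ← pairing_eq, MultilinearMap.map_smul_univ, smul_eq_mul,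
    Finset.prod_pow]

theorem cubicEval_perm (x : SymmetricPower ℂ (Fin 3) (SymmetricPower ℂ (Fin k) (Fin 2 → ℂ)))
    (φ : Fin 3 → Fin 2 → ℂ) (e : Equiv.Perm (Fin 3)) :
    cubicEval x (fun i => φ (e i)) = cubicEval x φ :=
  pairingForm_perm (fun i => evalForm k (φ i)) e x

theorem cubicEval_symPow (x : SymmetricPower ℂ (Fin 3) (SymmetricPower ℂ (Fin k) (Fin 2 → ℂ)))
    (φ : Fin 3 → Fin 2 → ℂ) (g : SL(2, ℂ)) :
    cubicEval (symPow (symPow stdSL2 k) 3 g x) φ =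
      cubicEval x fun i => Matrix.vecMul (φ i) (g : Matrix (Fin 2) (Fin 2) ℂ) := by
  simp only [cubicEval, ← evalForm_comp_symPow]
  exact pairingForm_symMap _ _ _

theorem eq_zero_of_cubicEval
    {x : SymmetricPower ℂ (Fin 3) (SymmetricPower ℂ (Fin k) (Fin 2 → ℂ))}
    (h : ∀ t : Fin 3 → ℂ, Function.Injective t → cubicEval x (fun i => ![1, t i]) = 0) : x = 0 :=
  eq_zero_of_pairing_eq_zero (eq_zero_of_evalForm_triple _ h)

/-- `SL_2` moves any three distinct points of the projective line to a fixed triple. -/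
theorem exists_specialLinear_triple (t : Fin 3 → ℂ) (ht : Function.Injective t) :
    ∃ (g : SL(2, ℂ)) (c : Fin 3 → ℂ), (∀ i, c i ≠ 0) ∧
      ∀ i, Matrix.vecMul ((![![1, 1], ![1, -1], ![1, 0]] : Fin 3 → Fin 2 → ℂ) i)
        (g : Matrix (Fin 2) (Fin 2) ℂ) = c i • ![1, t i] := by
  have h01 : t 1 - t 0 ≠ 0 := sub_ne_zero.2 (ht.ne (by decide))
  have h12 : t 1 - t 2 ≠ 0 := sub_ne_zero.2 (ht.ne (by decide))
  have h20 : t 2 - t 0 ≠ 0 := sub_ne_zero.2 (ht.ne (by decide))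
  -- The scalar `l` normalises the determinant of the matrix below to 1.
  obtain ⟨l, hl⟩ := IsAlgClosed.exists_pow_nat_eq
    (-(2 * (t 1 - t 2) * (t 2 - t 0) * (t 1 - t 0)))⁻¹ (n := 2) (by norm_num)
  have hl1 : l ^ 2 * (-(2 * (t 1 - t 2) * (t 2 - t 0) * (t 1 - t 0))) = 1 := by
    rw [hl]
    exact inv_mul_cancel₀ (by simp [h01, h12, h20])
  have hl0 : l ≠ 0 := by
    rintro rfl
    simp at hl1
  -- The rows are `l` times the sum and difference of (t₁ - t₂)(1, t₀) and (t₂ - t₀)(1, t₁); the sum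
  -- equals (t₁ - t₀)(1, t₂).
  refine ⟨⟨!![l * (t 1 - t 0), l * (t 1 - t 0) * t 2;
      l * (t 1 - t 2 - (t 2 - t 0)), l * ((t 1 - t 2) * t 0 - (t 2 - t 0) * t 1)], ?_⟩,
    ![2 * l * (t 1 - t 2), 2 * l * (t 2 - t 0), l * (t 1 - t 0)], ?_, ?_⟩
  · rw [Matrix.det_fin_two_of]
    linear_combination hl1
  · intro i
    fin_cases i <;> simp [hl0, h01, h12, h20]
  · intro i
    fin_cases i <;> ext j <;> fin_cases j <;>
      simp [Matrix.vecMul, dotProduct, Fin.sum_univ_two] <;> ring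

theorem cubicEval_ne_zero_of_semiinvariant
    {x : SymmetricPower ℂ (Fin 3) (SymmetricPower ℂ (Fin k) (Fin 2 → ℂ))} (hx : x ≠ 0)
    (h : ∀ g, ∃ c : ℂ, symPow (symPow stdSL2 k) 3 g x = c • x) :
    cubicEval x ![![1, 1], ![1, -1], ![1, 0]] ≠ 0 := by
  intro h0
  refine hx (eq_zero_of_cubicEval fun t ht => ?_)
  obtain ⟨g, c, hc, hg⟩ := exists_specialLinear_triple t ht
  obtain ⟨d, hd⟩ := h g
  have h1 := cubicEval_symPow x ![![1, 1], ![1, -1], ![1, 0]] g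
  rw [hd, cubicEval_smul_left, h0, mul_zero, funext hg, cubicEval_smul] at h1
  exact (mul_eq_zero.1 h1.symm).resolve_left
    (pow_ne_zero _ (Finset.prod_ne_zero_iff.2 fun i _ => hc i))

/-- The diagonal matrix with entries `i, -i`, which is a commutator in `SL_2(ℂ)`. -/
def diagI : SL(2, ℂ) := ⟨!![Complex.I, 0; 0, -Complex.I], by simp⟩

/-- The commutator of diag(t, t⁻¹) with the Weyl element is diag(t², t⁻²); take t² = i. -/
theorem exists_commutator_diagI : ∃ a b : SL(2, ℂ), a * b = diagI * (b * a) := by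
  obtain ⟨t, ht⟩ := IsAlgClosed.exists_pow_nat_eq Complex.I (n := 2) (by norm_num)
  have ht0 : t ≠ 0 := by
    rintro rfl
    simp at ht
    exact Complex.I_ne_zero ht.symm
  have ht1 : t⁻¹ = -Complex.I * t := by
    rw [inv_eq_iff_eq_inv, eq_comm, inv_eq_iff_eq_inv, eq_comm]
    refine inv_eq_of_mul_eq_one_left ?_
    linear_combination -Complex.I * ht - Complex.I_mul_I
  refine ⟨⟨!![t, 0; 0, t⁻¹], by simp [ht0]⟩, ⟨!![0, 1; -1, 0], by simp⟩, ?_⟩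
  refine Subtype.ext ?_
  change !![t, 0; 0, t⁻¹] * !![0, 1; -1, 0] =
    !![Complex.I, 0; 0, -Complex.I] * (!![0, 1; -1, 0] * !![t, 0; 0, t⁻¹])
  rw [ht1]
  ext i j
  fin_cases i <;> fin_cases j <;> simp
  linear_combination t * Complex.I_mul_I

theorem ne_zero_of_apply_eq_smul {H V : Type} [Group H] [AddCommMonoid V] [Module ℂ V]
    (ρ : Representation ℂ H V) {v : V} (hv : v ≠ 0) {h : H} {c : ℂ} (hc : ρ h v = c • v) :
    c ≠ 0 := by
  rintro rfl
  rw [zero_smul] at hc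
  exact hv (by simpa using (ρ.inv_self_apply h v).symm.trans (by rw [hc, map_zero]))

/-- The scalars commute, so a commutator acts trivially on a semi-invariant line. -/
theorem apply_diagI_of_semiinvariant
    {V : Type} [AddCommMonoid V] [Module ℂ V] (ρ : Representation ℂ SL(2, ℂ) V) {x : V}
    (h : ∀ g, ∃ c : ℂ, ρ g x = c • x) : ρ diagI x = x := by
  obtain ⟨a, b, hab⟩ := exists_commutator_diagI
  have h1 : ρ (a * b) x = ρ (b * a) x := by
    obtain ⟨c, hc⟩ := h a
    obtain ⟨d, hd⟩ := h b
    simp [hc, hd, smul_smul, mul_comm]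
  have h2 : ρ (a * b) x = ρ diagI (ρ (b * a) x) := by rw [hab, map_mul, Module.End.mul_apply]
  rw [h1] at h2
  obtain ⟨c, hc⟩ := h (b * a)
  rw [hc, map_smul] at h2
  rcases eq_or_ne x 0 with rfl | hx0
  · exact map_zero _
  · exact ((IsUnit.mk0 c (ne_zero_of_apply_eq_smul ρ hx0 hc)).smul_left_cancel.1 h2).symm

theorem four_dvd_of_semiinvariant
    {x : SymmetricPower ℂ (Fin 3) (SymmetricPower ℂ (Fin k) (Fin 2 → ℂ))} (hx : x ≠ 0)
    (h : ∀ g, ∃ c : ℂ, symPow (symPow stdSL2 k) 3 g x = c • x) : 4 ∣ k := by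
  have h0 := cubicEval_ne_zero_of_semiinvariant hx h
  have h1 := cubicEval_symPow x ![![1, 1], ![1, -1], ![1, 0]] diagI
  have hd : symPow (symPow stdSL2 k) 3 diagI x = x :=
    apply_diagI_of_semiinvariant _ h
  rw [hd] at h1
  -- `diagI` swaps the directions (1, 1) and (1, -1) and fixes (1, 0), with factor i each time.
  have h2 (i : Fin 3) :
      Matrix.vecMul ((![![1, 1], ![1, -1], ![1, 0]] : Fin 3 → Fin 2 → ℂ) i)
        (diagI : Matrix (Fin 2) (Fin 2) ℂ) =
      Complex.I • (![![1, 1], ![1, -1], ![1, 0]] : Fin 3 → Fin 2 → ℂ) (Equiv.swap 0 1 i) := by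
    fin_cases i <;> ext j <;> fin_cases j <;>
      simp [diagI, Matrix.vecMul, dotProduct, Fin.sum_univ_two, Equiv.swap_apply_def]
  rw [funext h2, cubicEval_smul (fun _ => Complex.I)
    x (fun i => (![![1, 1], ![1, -1], ![1, 0]] : Fin 3 → Fin 2 → ℂ) (Equiv.swap 0 1 i)),
    cubicEval_perm] at h1
  have h3 : Complex.I ^ (3 * k) = 1 := by
    rw [pow_mul]
    simpa using mul_right_cancel₀ h0 (h1.symm.trans (one_mul _).symm)
  have h4 := (IsPrimitiveRoot.iff_def Complex.I 4).1 Complex.isPrimitiveRoot_I |>.2 _ h3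
  omega

end CubicInvariants

/-! ### The invariant cubic from brackets -/

section InvariantCubic

/-- The product of the three brackets of three vectors in the plane. -/
def bracketProd (φ : Fin 3 → Fin 2 → ℂ) : ℂ :=
  (φ 0 0 * φ 1 1 + -(φ 0 1 * φ 1 0)) * (φ 1 0 * φ 2 1 + -(φ 1 1 * φ 2 0)) *
    (φ 2 0 * φ 0 1 + -(φ 2 1 * φ 0 0))

/-- The product of brackets changes only by the sign of the permutation. -/
theorem bracketProd_perm_sq (φ : Fin 3 → Fin 2 → ℂ) (e : Equiv.Perm (Fin 3)) :
    bracketProd (fun i => φ (e i)) ^ 2 = bracketProd φ ^ 2 := by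
  have h01 : e 0 ≠ e 1 := e.injective.ne (by decide)
  have h02 : e 0 ≠ e 2 := e.injective.ne (by decide)
  have h12 : e 1 ≠ e 2 := e.injective.ne (by decide)
  simp only [bracketProd]
  generalize e 0 = a at *
  generalize e 1 = b at *
  generalize e 2 = c at *
  fin_cases a <;> fin_cases b <;> fin_cases c <;>
    first | exact absurd rfl h01 | exact absurd rfl h02 | exact absurd rfl h12 | rfl | (dsimp; ring)

theorem bracketProd_vecMul (φ : Fin 3 → Fin 2 → ℂ) (g : SL(2, ℂ)) :
    bracketProd (fun i => Matrix.vecMul (φ i) (g : Matrix (Fin 2) (Fin 2) ℂ)) =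
      bracketProd φ := by
  have hg : g 0 0 * g 1 1 - g 0 1 * g 1 0 = 1 := by
    rw [← Matrix.det_fin_two, g.det_coe]
  have h (i j : Fin 3) :
      Matrix.vecMul (φ i) (g : Matrix (Fin 2) (Fin 2) ℂ) 0 * Matrix.vecMul (φ j) g.1 1 +
        -(Matrix.vecMul (φ i) (g : Matrix (Fin 2) (Fin 2) ℂ) 1 * Matrix.vecMul (φ j) g.1 0) =
      φ i 0 * φ j 1 + -(φ i 1 * φ j 0) := by
    simp only [Matrix.vecMul, dotProduct, Fin.sum_univ_two]
    linear_combination (φ i 0 * φ j 1 - φ i 1 * φ j 0) * hg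
  simp only [bracketProd, h]

/-- The cubic tensor whose trihomogeneous function is the symmetrization of the `m`-th power of
the product of brackets. -/
def invariantCubic (m : ℕ) :
    SymmetricPower ℂ (Fin 3) (SymmetricPower ℂ (Fin (2 * m)) (Fin 2 → ℂ)) :=
  ∑ a ∈ Finset.range (m + 1), ∑ b ∈ Finset.range (m + 1), ∑ c ∈ Finset.range (m + 1),
    ((-1) ^ (m - a) * (-1) ^ (m - b) * (-1) ^ (m - c) * (m.choose a * m.choose b * m.choose c) : ℂ) •
      SymmetricPower.tprod ℂ ![monomialForm (2 * m) (a + (m - c)),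
        monomialForm (2 * m) (b + (m - a)), monomialForm (2 * m) (c + (m - b))]

/-- Binomial expansion of each bracket. Every point lies in two brackets, whence degree 2m in each.
-/
theorem bracketProd_pow (m : ℕ) (φ : Fin 3 → Fin 2 → ℂ) :
    bracketProd φ ^ m =
      ∑ a ∈ Finset.range (m + 1), ∑ b ∈ Finset.range (m + 1), ∑ c ∈ Finset.range (m + 1),
        ((-1) ^ (m - a) * (-1) ^ (m - b) * (-1) ^ (m - c) *
          (m.choose a * m.choose b * m.choose c) : ℂ) *
        ∏ i, evalForm (2 * m) (φ i) ((![monomialForm (2 * m) (a + (m - c)),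
        monomialForm (2 * m) (b + (m - a)), monomialForm (2 * m) (c + (m - b))] : Fin 3 → _) i) := by
  rw [bracketProd, mul_pow, mul_pow, add_pow, add_pow, add_pow, Finset.sum_mul_sum,
    Finset.sum_mul]
  refine Finset.sum_congr rfl fun a ha => ?_
  rw [Finset.sum_mul]
  refine Finset.sum_congr rfl fun b hb => ?_
  rw [Finset.mul_sum]
  refine Finset.sum_congr rfl fun c hc => ?_
  rw [Finset.mem_range] at ha hb hc
  rw [Fin.prod_univ_three]
  simp only [Matrix.cons_val_zero, Matrix.cons_val_one, Matrix.cons_val]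
  rw [evalForm_monomialForm (by omega), evalForm_monomialForm (by omega),
    evalForm_monomialForm (by omega), show 2 * m - (a + (m - c)) = c + (m - a) by omega,
    show 2 * m - (b + (m - a)) = a + (m - b) by omega,
    show 2 * m - (c + (m - b)) = b + (m - c) by omega]
  rw [neg_pow (φ 0 1 * φ 1 0), neg_pow (φ 1 1 * φ 2 0), neg_pow (φ 2 1 * φ 0 0)]
  simp only [mul_pow, pow_add]
  ring

/-- The pairing sums over six permutations; for even `m` the summands agree instead of cancelling.
-/
theorem cubicEval_invariantCubic {m : ℕ} (hm : Even m) (φ : Fin 3 → Fin 2 → ℂ) :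
    cubicEval (invariantCubic m) φ = 6 * bracketProd φ ^ m := by
  have h1 : cubicEval (invariantCubic m) φ =
      ∑ σ : Equiv.Perm (Fin 3), bracketProd (fun i => φ (σ i)) ^ m := by
    simp only [cubicEval, invariantCubic, map_sum, map_smul, pairingForm_tprod', smul_eq_mul,
      bracketProd_pow, Finset.mul_sum]
    symm
    rw [Finset.sum_comm]
    refine Finset.sum_congr rfl fun a _ => ?_
    rw [Finset.sum_comm]
    refine Finset.sum_congr rfl fun b _ => ?_
    rw [Finset.sum_comm]
  obtain ⟨j, rfl⟩ := hm
  rw [h1, Finset.sum_congr rfl fun σ _ => (by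
    rw [← two_mul, pow_mul, pow_mul, bracketProd_perm_sq] :
      bracketProd (fun i => φ (σ i)) ^ (j + j) = bracketProd φ ^ (j + j))]
  simp [Fintype.card_perm, Nat.factorial]

theorem symPow_invariantCubic {m : ℕ} (hm : Even m) (g : SL(2, ℂ)) :
    symPow (symPow stdSL2 (2 * m)) 3 g (invariantCubic m) = invariantCubic m := by
  refine sub_eq_zero.1 (eq_zero_of_cubicEval fun t _ => ?_)
  rw [cubicEval_sub, cubicEval_symPow, cubicEval_invariantCubic hm, cubicEval_invariantCubic hm,
    bracketProd_vecMul, sub_self]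

theorem invariantCubic_ne_zero {m : ℕ} (hm : Even m) : invariantCubic m ≠ 0 := by
  intro h
  have h1 := cubicEval_invariantCubic hm ![![1, 0], ![0, 1], ![1, 1]]
  simp [h, cubicEval, bracketProd] at h1

theorem exists_invariant_cubic {k : ℕ} (hk : 4 ∣ k) :
    ∃ x : SymmetricPower ℂ (Fin 3) (SymmetricPower ℂ (Fin k) (Fin 2 → ℂ)), x ≠ 0 ∧
      ∀ g, symPow (symPow stdSL2 k) 3 g x = x := by
  obtain ⟨j, rfl⟩ := hk
  obtain ⟨m, hm, h⟩ : ∃ m, Even m ∧ 4 * j = 2 * m := ⟨2 * j, even_two_mul j, by ring⟩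
  rw [h]
  exact ⟨invariantCubic m, invariantCubic_ne_zero hm, symPow_invariantCubic hm⟩

end InvariantCubic

/-! ### From fixed lines in GLₙ to semi-invariant vectors -/

section Detection

theorem symMap_comp {M N P ι : Type} [AddCommGroup M] [Module ℂ M]
    [AddCommGroup N] [Module ℂ N] [AddCommGroup P] [Module ℂ P] (f : N →ₗ[ℂ] P) (g : M →ₗ[ℂ] N)
    (x : SymmetricPower ℂ ι M) : symMap f (symMap g x) = symMap (f ∘ₗ g) x :=
  LinearMap.congr_fun (f := symMap f ∘ₗ symMap g)
    (sym_hom_ext fun m => by simp [symMap_tprod]) x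

theorem symMap_id {M ι : Type} [AddCommGroup M] [Module ℂ M] (x : SymmetricPower ℂ ι M) :
    symMap LinearMap.id x = x :=
  LinearMap.congr_fun (g := LinearMap.id) (sym_hom_ext fun m => by simp [symMap_tprod]) x

/-- Coordinates intertwine `ρ` with its matrix form, which makes detection independent of the basis.
-/
theorem stdGL_matrixHom {H M : Type} [Group H] [AddCommGroup M] [Module ℂ M] {n : ℕ}
    (ρ : Representation ℂ H M) (b : Module.Basis (Fin n) ℂ M) (h : H) :
    stdGL n (matrixHom ρ b h) ∘ₗ b.equivFun.toLinearMap = b.equivFun.toLinearMap ∘ₗ ρ h := by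
  ext x
  exact congr_fun (LinearMap.toMatrix_mulVec_repr b b (ρ h) x) _

theorem detects_iff {n : ℕ} {V : Type} [AddCommGroup V] [Module ℂ V]
    (r : Representation ℂ (GL (Fin n) ℂ) V) (G : Subgroup (GL (Fin n) ℂ)) :
    Detects r G ↔ ∃ v ≠ 0, ∀ g ∈ G, ∃ c : ℂ, r g v = c • v := by
  constructor
  · rintro ⟨L, hL, hG⟩
    obtain ⟨v, hv0, hv⟩ := finrank_eq_one_iff'.1 hL
    refine ⟨v, fun h0 => hv0 (Subtype.ext h0), fun g hg => ?_⟩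
    have hmem : r g v ∈ L := (hG g hg).le (Submodule.mem_map_of_mem v.2)
    obtain ⟨c, hc⟩ := hv ⟨_, hmem⟩
    exact ⟨c, (congr_arg Subtype.val hc).symm⟩
  · rintro ⟨v, hv0, hv⟩
    refine ⟨Submodule.span ℂ {v}, finrank_span_singleton hv0, fun g hg => ?_⟩
    obtain ⟨c, hc⟩ := hv g hg
    rw [Submodule.map_span, Set.image_singleton, hc]
    exact Submodule.span_singleton_smul_eq (IsUnit.mk0 c (ne_zero_of_apply_eq_smul r hv0 hc)) _

/-- The image of a representation in `GL_n` is detected by a symmetric power exactly when that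
symmetric power of the representation has a nonzero semi-invariant vector. -/
theorem detects_range_matrixHom_iff {H M : Type} [Group H] [AddCommGroup M] [Module ℂ M] {n : ℕ}
    (ρ : Representation ℂ H M) (b : Module.Basis (Fin n) ℂ M) (d : ℕ) :
    Detects (symPow (stdGL n) d) (matrixHom ρ b).range ↔
      ∃ x ≠ 0, ∀ h, ∃ c : ℂ, symPow ρ d h x = c • x := by
  let e := b.equivFun
  have he (x) : symMap (ι := Fin d) e.symm.toLinearMap (symMap e.toLinearMap x) = x := by
    rw [symMap_comp, LinearEquiv.symm_comp, symMap_id]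
  have he' (x) : symMap (ι := Fin d) e.toLinearMap (symMap e.symm.toLinearMap x) = x := by
    rw [symMap_comp, LinearEquiv.comp_symm, symMap_id]
  have hequiv (h : H) (x) : symPow (stdGL n) d (matrixHom ρ b h) (symMap e.toLinearMap x) =
      symMap e.toLinearMap (symPow ρ d h x) := by
    refine (symMap_comp _ _ x).trans (.trans ?_ (symMap_comp _ _ x).symm)
    exact congr_arg (fun f => symMap f x) (stdGL_matrixHom ρ b h)
  refine (detects_iff _ _).trans ⟨?_, ?_⟩
  · rintro ⟨v, hv0, hv⟩
    refine ⟨symMap e.symm.toLinearMap v, fun h0 => hv0 ?_, fun h => ?_⟩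
    · rw [← he' v, h0, map_zero]
    · obtain ⟨c, hc⟩ := hv _ ⟨h, rfl⟩
      refine ⟨c, ?_⟩
      have h1 := hequiv h (symMap e.symm.toLinearMap v)
      rw [he'] at h1
      rw [← he (symPow ρ d h _), ← h1, ← map_smul]
      exact congr_arg _ hc
  · rintro ⟨x, hx0, hx⟩
    refine ⟨symMap e.toLinearMap x, fun h0 => hx0 (by rw [← he x, h0, map_zero]), ?_⟩
    rintro _ ⟨h, rfl⟩
    obtain ⟨c, hc⟩ := hx h
    exact ⟨c, by rw [hequiv, hc, map_smul]⟩

end Detection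

end SymDetect

end

theorem theorem3p2 (n : ℕ) (hn : 1 ≤ n) :
    Module.finrank ℂ (SymmetricPower ℂ (Fin (n - 1)) (Fin 2 → ℂ)) = n ∧
    (∀ b : Module.Basis (Fin n) ℂ (SymmetricPower ℂ (Fin (n - 1)) (Fin 2 → ℂ)),
      SymDetect.Detects (SymDetect.symPow (SymDetect.stdGL n) 3) (SymDetect.symSL2 b) ↔
        n ≡ 1 [MOD 4]) ∧
    ((∃ v ∈ (SymDetect.symPow (SymDetect.symPow SymDetect.stdSL2 (n - 1)) 3).invariants, v ≠ 0) ↔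
      4 ∣ n - 1) := by
  refine ⟨?_, fun b => ?_, ?_⟩
  · rw [SymDetect.finrank_symPow]
    omega
  · rw [SymDetect.symSL2, SymDetect.detects_range_matrixHom_iff]
    have hmod : n ≡ 1 [MOD 4] ↔ 4 ∣ n - 1 := by
      rw [Nat.ModEq.comm, Nat.modEq_iff_dvd' hn]
    rw [hmod]
    constructor
    · rintro ⟨x, hx0, hx⟩
      exact SymDetect.four_dvd_of_semiinvariant hx0 hx
    · intro h
      obtain ⟨x, hx0, hx⟩ := SymDetect.exists_invariant_cubic h
      exact ⟨x, hx0, fun g => ⟨1, by rw [hx g, one_smul]⟩⟩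
  · constructor
    · rintro ⟨x, hx, hx0⟩
      exact SymDetect.four_dvd_of_semiinvariant hx0 fun g => ⟨1, by rw [hx g, one_smul]⟩
    · intro h
      obtain ⟨x, hx0, hx⟩ := SymDetect.exists_invariant_cubic h
      exact ⟨x, hx, hx0⟩
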